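/- Work over $\mathbb{C}$. Let $\mathbb{P}^{14}$ be the projective space of ternary quartics, with coordinates $f_\alpha$ given by $F=\sum_{|\alpha|=4}\frac{4!}{\alpha!}f_\alpha x^\alpha$, $x=(x_1,x_2,x_3)$. Let $v_4(\mathbb{P}^2)\subset\mathbb{P}^{14}$ be the Veronese variety of fourth powers of linear forms, and for $k\ge 1$ let $\sigma_k(v_d(\mathbb{P}^n))$ denote the Zariski closure of the union of the projective subspaces spanned by $k$ points of $v_d(\mathbb{P}^n)$. For $a=(a_1,a_2,a_3)$, $b$, $c$ vectors of variables, let $(abc)$ be the determinant of the $3\times 3$ matrix with rows $a,b,c$. Put $$\mathcal{S}=(abc)^2(ade)(adf)(bdf)(bef)(cde)(cef),\qquad \mathcal{I}(F)=\Big(\prod_{u\in\{a,b,c,d,e,f\}}\tfrac{1}{4!}F\big(\tfrac{\partial}{\partial u_1},\tfrac{\partial}{\partial u_2},\tfrac{\partial}{\partial u_3}\big)\Big)\,\mathcal{S}.$$ The collinearity graph of a product of determinants has the letters as vertices, two distinct letters being adjacent when they occur together in some determinant. Then: (i) in $\mathcal S$ every determinant has three distinct letters and every letter occurs in exactly four determinants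 (counted with multiplicity), and $\mathcal{I}$ is a homogeneous polynomial of degree $6$ in the $f_\alpha$, invariant under the action of $SL_3(\mathbb{C})$ by linear substitutions; (ii) $\mathcal{I}$ is not identically zero; (iii) $\sigma_5(v_4(\mathbb{P}^2))$ has codimension $1$ in $\mathbb{P}^{14}$, it is the zero locus of $\mathcal{I}$, and $\mathcal{I}$ is its defining equation, i.e. generates the ideal of all polynomials vanishing on it; (iv) the collinearity graph of $\mathcal{S}$ is the complete graph $K_6$; it has no proper $5$-coloring and its chromatic number is $6$; (v) $\mathcal{I}(L_1^4+\dots+L_5^4)=0$ for all linear forms $L_1,\dots,L_5$ in three variables. Consequently the triple $(5,4,2)$ is chromatic, where $(k,d,n)$ is called chromatic if $\sigma_k(v_d(\mathbb{P}^n))$ has codimension $1$ and there is a product of $(n+1)\times(n+1)$ determinants, each with $n+1$ distinct letters and with every letter occurring in exactly $d$ of them, whose associated polynomial (defined as above, using the operators $\frac{1}{d!}F(\partial/\partial u)$ with $F$ of degree $d$ in $n+1$ variables) generates the ideal of $\sigma_k(v_d(\mathbb{P}^n))$ and whose collinearity graph has chromatic number $k+1$. -/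

import Mathlib

noncomputable section

namespace VeroneseSecant

/-- Multi-indices `α = (α₀, …, αₙ)` of nonnegative integers with `|α| = d`. -/
abbrev MultiIndex (n d : ℕ) : Type :=
  ↥((Finset.univ : Finset (Fin (n + 1))).finsuppAntidiag d)

/-- The space of forms (homogeneous polynomials) of degree `d` in `n + 1` variables over `ℂ`. -/
abbrev Form (n d : ℕ) : Type :=
  ↥(MvPolynomial.homogeneousSubmodule (Fin (n + 1)) ℂ d)

/-- The ring of polynomials in the coefficients `f_α` of a form of degree `d` in `n + 1`
variables, written as `F = ∑_α (d! / α!) f_α x^α`. -/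
abbrev CoordRing (n d : ℕ) : Type := MvPolynomial (MultiIndex n d) ℂ

/-- The coefficients `f_α` of `F = ∑_α (d! / α!) f_α x^α`. -/
def coords (n d : ℕ) (F : MvPolynomial (Fin (n + 1)) ℂ) (α : MultiIndex n d) : ℂ :=
  F.coeff α.1 / (α.1.multinomial : ℂ)

/-- The form `∑_α (d! / α!) f_α x^α` whose coefficients `f_α` are independent variables. -/
def genericForm (n d : ℕ) : MvPolynomial (Fin (n + 1)) (CoordRing n d) :=
  ∑ α : MultiIndex n d,
    MvPolynomial.monomial α.1 ((α.1.multinomial : CoordRing n d) * MvPolynomial.X α)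

/-! ### Secant varieties of Veronese varieties -/

/-- `P` vanishes at the point `p` of the projective space of forms, that is, on the line `p`
(equivalently, all homogeneous components of `P` vanish at `p`). -/
def VanishesAt {n d : ℕ} (P : CoordRing n d) (p : Projectivization ℂ (Form n d)) : Prop :=
  ∀ F ∈ p.submodule, MvPolynomial.eval (coords n d F.1) P = 0

/-- The (homogeneous) ideal of all polynomials vanishing on a set of points of projective space. -/
def vanishingIdeal {n d : ℕ} (S : Set (Projectivization ℂ (Form n d))) :
    Ideal (CoordRing n d) where
  carrier := {P | ∀ p ∈ S, VanishesAt P p}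
  zero_mem' := fun p _ F _ => by simp
  add_mem' := fun {P Q} hP hQ p hp F hF => by
    rw [map_add, hP p hp F hF, hQ p hp F hF, add_zero]
  smul_mem' := fun c P hP p hp F hF => by
    rw [smul_eq_mul, map_mul, hP p hp F hF, mul_zero]

/-- Zariski closure in the projective space of forms. -/
def zariskiClosure {n d : ℕ} (S : Set (Projectivization ℂ (Form n d))) :
    Set (Projectivization ℂ (Form n d)) :=
  {p | ∀ P ∈ vanishingIdeal S, VanishesAt P p}

/-- Codimension in projective space of a Zariski closed set: the height of its ideal. -/
def codimension {n d : ℕ} (S : Set (Projectivization ℂ (Form n d))) : ℕ∞ :=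
  (vanishingIdeal S).height

/-- The Veronese variety `v_d(ℙⁿ)`: the classes of the nonzero powers `L ^ d` of linear forms. -/
def veronese (n d : ℕ) : Set (Projectivization ℂ (Form n d)) :=
  {p | ∃ (F : Form n d) (hF : F ≠ 0) (L : MvPolynomial (Fin (n + 1)) ℂ),
    L.IsHomogeneous 1 ∧ F.1 = L ^ d ∧ p = Projectivization.mk ℂ F hF}

/-- `σ_k(X)`: the Zariski closure of the union of the projective subspaces spanned by
`k` points of `X`. -/
def secantVariety {n d : ℕ} (k : ℕ) (X : Set (Projectivization ℂ (Form n d))) :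
    Set (Projectivization ℂ (Form n d)) :=
  zariskiClosure {p | ∃ q : Fin k → Projectivization ℂ (Form n d),
    (∀ i, q i ∈ X) ∧ p.submodule ≤ ⨆ i, (q i).submodule}

/-! ### Symbolic expressions -/

/-- A product of `m` determinants (brackets) of size `n + 1` in `r` symbolic letters:
the rows of the determinant number `b` are the letters `w b 0, …, w b n`.
It encodes a hypergraph with vertices the letters and with `m` (possibly repeated) blocks. -/
abbrev BracketMonomial (n r m : ℕ) : Type := Fin m → Fin (n + 1) → Fin r

namespace BracketMonomial

/-- Each block has `n + 1` different vertices, and each vertex lies in exactly `d` blocks. -/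
def IsBiregular {n r m : ℕ} (w : BracketMonomial n r m) (d : ℕ) : Prop :=
  (∀ b, Function.Injective (w b)) ∧
    ∀ v, (Finset.univ.filter fun b => ∃ i, w b i = v).card = d

/-- The product of determinants itself, a polynomial in the `r (n + 1)` variables `a_j`,
for `a` a letter and `j` an index. -/
def symbol {n r m : ℕ} (w : BracketMonomial n r m) (R : Type) [CommRing R] :
    MvPolynomial (Fin r × Fin (n + 1)) R :=
  ∏ b : Fin m, (Matrix.of fun i j : Fin (n + 1) =>
    (MvPolynomial.X (w b i, j) : MvPolynomial (Fin r × Fin (n + 1)) R)).det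

/-- The differential operator `F(∂/∂a_0, …, ∂/∂a_n)` for the letter `a`. -/
def letterOperator {n r : ℕ} {R : Type} [CommRing R] (F : MvPolynomial (Fin (n + 1)) R)
    (a : Fin r) : Module.End R (MvPolynomial (Fin r × Fin (n + 1)) R) :=
  ∑ α ∈ F.support, F.coeff α •
    (List.ofFn fun j : Fin (n + 1) =>
      ((MvPolynomial.pderiv (R := R) (a, j)).toLinearMap :
        Module.End R (MvPolynomial (Fin r × Fin (n + 1)) R)) ^ α j).prod

/-- The polynomial in the coefficients of a form `F` of degree `d` with the given symbolic
expression: apply the product over all letters `a` of the operators `(1/d!) F(∂/∂a)` to the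
product of determinants. (When every letter occurs `d` times the result is a constant
polynomial in the letters, so that taking its constant coefficient loses nothing.) -/
def invariant {n r m : ℕ} (w : BracketMonomial n r m) (d : ℕ) : CoordRing n d :=
  MvPolynomial.constantCoeff
    ((List.ofFn fun a : Fin r =>
      ((d.factorial : ℂ)⁻¹) • letterOperator (genericForm n d) a).prod (w.symbol (CoordRing n d)))

/-- The collinearity graph: different letters are adjacent if they lie in a common block. -/
def collinearityGraph {n r m : ℕ} (w : BracketMonomial n r m) : SimpleGraph (Fin r) where
  Adj u v := u ≠ v ∧ ∃ b, (∃ i, w b i = u) ∧ ∃ j, w b j = v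
  symm := ⟨fun _ _ h => ⟨h.1.symm, h.2.imp fun _ hb => ⟨hb.2, hb.1⟩⟩⟩
  loopless := ⟨fun _ h => h.1 rfl⟩

end BracketMonomial

/-- The triple `(k, d, n)` is chromatic: `σ_k(v_d(ℙⁿ))` has codimension one, and its defining
equation (the generator of its ideal, up to a nonzero constant) is given by a single bracket
monomial with the appropriate degrees whose collinearity graph has chromatic number `k + 1`. -/
def IsChromaticTriple (k d n : ℕ) : Prop :=
  codimension (secantVariety k (veronese n d)) = 1 ∧
    ∃ (r m : ℕ) (w : BracketMonomial n r m), w.IsBiregular d ∧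
      vanishingIdeal (secantVariety k (veronese n d)) = Ideal.span {w.invariant d} ∧
      w.collinearityGraph.chromaticNumber = (k + 1 : ℕ)

/-- `(abc)²(ade)(adf)(bdf)(bef)(cde)(cef)`, with the letters `a, …, f` numbered `0, …, 5`. -/
def quarticBrackets : BracketMonomial 2 6 8 :=
  ![![0, 1, 2], ![0, 1, 2], ![0, 3, 4], ![0, 3, 5], ![1, 3, 5], ![1, 4, 5], ![2, 3, 4], ![2, 4, 5]]

/-- The form `F(g x)` obtained from `F` by the linear substitution with matrix `g`. -/
def substitute {n : ℕ} (g : Matrix (Fin (n + 1)) (Fin (n + 1)) ℂ)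
    (F : MvPolynomial (Fin (n + 1)) ℂ) : MvPolynomial (Fin (n + 1)) ℂ :=
  MvPolynomial.aeval (fun i => ∑ j, MvPolynomial.C (g i j) * MvPolynomial.X j) F

end VeroneseSecant

end

noncomputable section

open MvPolynomial

namespace VeroneseSecant

/-! ### Iterated derivatives and the umbral formula -/

section Umbral

variable {n r : ℕ} {R : Type} [CommRing R]

/-! Two descriptions of the same hypersurface are compared. Evaluated at a sum of `d`-th powers of
linear forms `l i`, a bracket monomial becomes the sum, over all maps `σ` from letters to indices,
of the product of brackets with each letter `a` replaced by `l (σ a)` (`eval_invariant`). Any two of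
the six letters share a bracket, so only injective `σ` contribute: five powers give zero by
pigeonhole, and for six powers only permutations remain, whose sum at explicit points is nonzero.
Since every form is a sum of powers, the same formula gives `SL` invariance.

On the other side, the 6×6 catalecticant determinant vanishes on sums of five fourth powers, where
the matrix has rank at most five. It is irreducible and linear in the coefficient of `x⁴`.
Pseudo-dividing any polynomial that vanishes on those sums leaves a remainder free of that
coefficient; a Jacobian computation shows that the other 14 coefficients are algebraically
independent on such sums, so the remainder is zero. Hence the determinant generates the ideal
(`det_catMatrix_dvd`). The invariant is nonzero, lies in this ideal and has the same degree 6, so it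
is a constant multiple of the determinant. -/

lemma coeff_pderiv_pow {σ : Type*} (i : σ) (k : ℕ) (p : MvPolynomial σ R) (m : σ →₀ ℕ) :
    coeff m (((pderiv (R := R) i).toLinearMap ^ k : Module.End R (MvPolynomial σ R)) p) =
      ((m i + 1).ascFactorial k : R) * coeff (m + Finsupp.single i k) p := by
  induction k generalizing m with
  | zero => simp
  | succ k ih =>
    rw [pow_succ', Module.End.mul_apply, Derivation.coeFn_coe, coeff_pderiv, ih, add_assoc,
      ← Finsupp.single_add, add_comm 1 k]
    have h : ((m i + 1).ascFactorial (k + 1) : R) =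
        ((m i + 1 + 1).ascFactorial k : R) * (m i + 1) := by
      rw [Nat.ascFactorial_succ, ← Nat.succ_ascFactorial]
      push_cast
      ring
    rw [h]
    simp only [Finsupp.add_apply, Finsupp.single_eq_same]
    ring

/-- As `m` is zero at the differentiated variables, each rising factorial starts at 1 and equals `(α
j)!`; distinctness of the indices preserves this through the induction. -/
lemma coeff_prod_pderiv_pow (a : Fin r) (α : Fin (n + 1) →₀ ℕ)
    (p : MvPolynomial (Fin r × Fin (n + 1)) R) (js : List (Fin (n + 1))) (hjs : js.Nodup)
    (m : Fin r × Fin (n + 1) →₀ ℕ) (hm : ∀ j ∈ js, m (a, j) = 0) :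
    coeff m ((js.map fun j => ((pderiv (R := R) (a, j)).toLinearMap :
        Module.End R (MvPolynomial (Fin r × Fin (n + 1)) R)) ^ α j).prod p) =
      ((js.map fun j => (α j).factorial).prod : R) *
        coeff (m + (js.map fun j => Finsupp.single (a, j) (α j)).sum) p := by
  induction js generalizing m with
  | nil => simp
  | cons j js ih =>
    rw [List.nodup_cons] at hjs
    rw [List.map_cons, List.prod_cons, Module.End.mul_apply, coeff_pderiv_pow, ih hjs.2]
    · simp [hm j, Nat.one_ascFactorial, add_assoc, mul_assoc]
    · intro j' hj'
      have : j ≠ j' := fun h => hjs.1 (h ▸ hj')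
      simp [hm j' (by simp [hj']), this]

/-- The exponents of the variables belonging to the letter `a`. -/
def letterExponent (m : Fin r × Fin (n + 1) →₀ ℕ) (a : Fin r) : Fin (n + 1) →₀ ℕ :=
  Finsupp.equivFunOnFinite.symm fun j => m (a, j)

@[simp] lemma letterExponent_apply (m : Fin r × Fin (n + 1) →₀ ℕ) (a : Fin r)
    (j : Fin (n + 1)) : letterExponent m a j = m (a, j) := rfl

lemma mapDomain_mk_apply (a b : Fin r) (α : Fin (n + 1) →₀ ℕ) (j : Fin (n + 1)) :
    α.mapDomain (Prod.mk a) (b, j) = if a = b then α j else 0 := by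
  split_ifs with h
  · subst h
    exact Finsupp.mapDomain_apply (Prod.mk_right_injective a) _ _
  · exact Finsupp.mapDomain_of_notMem_range _ _ (by
      rintro ⟨j', hj'⟩
      exact h (by simpa using congrArg Prod.fst hj'))

lemma coeff_letterOperator (F : MvPolynomial (Fin (n + 1)) R) (a : Fin r)
    (p : MvPolynomial (Fin r × Fin (n + 1)) R) (m : Fin r × Fin (n + 1) →₀ ℕ)
    (hm : ∀ j, m (a, j) = 0) :
    coeff m (BracketMonomial.letterOperator F a p) =
      ∑ α ∈ F.support, F.coeff α * ((∏ j, (α j).factorial : ℕ) : R) *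
        coeff (m + α.mapDomain (Prod.mk a)) p := by
  rw [BracketMonomial.letterOperator, LinearMap.sum_apply, coeff_sum]
  refine Finset.sum_congr rfl fun α _ => ?_
  rw [LinearMap.smul_apply, coeff_smul, List.ofFn_eq_map,
    coeff_prod_pderiv_pow a α p _ (List.nodup_finRange _) m fun j _ => hm j, smul_eq_mul]
  have h1 : (List.map (fun j => Finsupp.single (a, j) (α j)) (List.finRange (n + 1))).sum =
      α.mapDomain (Prod.mk a) := by
    rw [← List.ofFn_eq_map, List.sum_ofFn, Finsupp.mapDomain, Finsupp.sum_fintype _ _ (by simp)]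
  have h2 : (List.map (fun j => (α j).factorial) (List.finRange (n + 1))).prod =
      ∏ j, (α j).factorial := by
    rw [← List.ofFn_eq_map, List.prod_ofFn]
  rw [h1, h2, mul_assoc]

lemma coeff_prod_letterOperator (F : MvPolynomial (Fin (n + 1)) R)
    (p : MvPolynomial (Fin r × Fin (n + 1)) R) (l : List (Fin r)) (hl : l.Nodup)
    (m : Fin r × Fin (n + 1) →₀ ℕ) (hm : ∀ a ∈ l, ∀ j, m (a, j) = 0) :
    coeff m ((l.map (BracketMonomial.letterOperator F)).prod p) =
      ∑ m' ∈ p.support, open scoped Classical in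
        if ∀ b ∉ l, ∀ j, m' (b, j) = m (b, j) then
        coeff m' p * (l.map fun a => ((∏ j, (m' (a, j)).factorial : ℕ) : R) *
          F.coeff (letterExponent m' a)).prod else 0 := by
  classical
  induction l generalizing m with
  | nil =>
    have : ∀ m' : Fin r × Fin (n + 1) →₀ ℕ,
        (∀ b ∉ ([] : List (Fin r)), ∀ j, m' (b, j) = m (b, j)) ↔ m' = m := fun m' =>
      ⟨fun h => Finsupp.ext fun ⟨b, j⟩ => h b (by simp) j, fun h => by simp [h]⟩
    simp only [this, List.map_nil, List.prod_nil, Module.End.one_apply, mul_one,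
      Finset.sum_ite_eq', mem_support_iff]
    split_ifs with h
    · rfl
    · simpa using h
  | cons a l ih =>
    rw [List.nodup_cons] at hl
    rw [List.map_cons, List.prod_cons, Module.End.mul_apply,
      coeff_letterOperator _ _ _ _ fun j => hm a (by simp) j]
    have hα : ∀ α : Fin (n + 1) →₀ ℕ, ∀ b ∈ l, ∀ j,
        (m + α.mapDomain (Prod.mk a)) (b, j) = 0 := fun α b hb j => by
      have : a ≠ b := fun h => hl.1 (h ▸ hb)
      simp [mapDomain_mk_apply, this, hm b (by simp [hb])]
    simp_rw [fun α => ih hl.2 _ (hα α), Finset.mul_sum]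
    rw [Finset.sum_comm]
    refine Finset.sum_congr rfl fun m' _ => ?_
    -- The operator of the letter `a` reaches a monomial `m'` through exactly one `α`, its own
    -- exponent at `a`; this collapses the double sum.
    have key : ∀ α : Fin (n + 1) →₀ ℕ,
        (∀ b ∉ l, ∀ j, m' (b, j) = (m + α.mapDomain (Prod.mk a)) (b, j)) ↔
          α = letterExponent m' a ∧ ∀ b ∉ a :: l, ∀ j, m' (b, j) = m (b, j) := by
      intro α
      simp only [Finsupp.add_apply, mapDomain_mk_apply]
      constructor
      · intro h
        refine ⟨Finsupp.ext fun j => ?_, fun b hb j => ?_⟩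
        · simp [h a hl.1 j, hm a]
        · rw [List.mem_cons, not_or] at hb
          simp [h b hb.2 j, Ne.symm hb.1]
      · rintro ⟨rfl, h⟩ b hb j
        by_cases hab : a = b
        · subst hab
          simp [hm a]
        · simpa [hab] using h b (by simp [hb, Ne.symm hab]) j
    simp_rw [key]
    by_cases hP : ∀ b ∉ a :: l, ∀ j, m' (b, j) = m (b, j)
    · rw [if_pos hP, Finset.sum_eq_single (letterExponent m' a)
        (fun α _ hα => by rw [if_neg fun h => hα h.1, mul_zero])
        (fun h => by rw [notMem_support_iff.1 h, zero_mul, zero_mul]), if_pos ⟨rfl, hP⟩]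
      simp only [letterExponent_apply, List.map_cons, List.prod_cons]
      ring
    · rw [if_neg hP, Finset.sum_eq_zero fun α _ => by rw [if_neg fun h => hP h.2, mul_zero]]

/-- The linear functional sending the monomial `∏_a a^{m_a}` in the letters to `∏_a φ(m_a)`. -/
def umbral (φ : (Fin (n + 1) →₀ ℕ) → R) (p : MvPolynomial (Fin r × Fin (n + 1)) R) : R :=
  ∑ m ∈ p.support, coeff m p * ∏ a, φ (letterExponent m a)

lemma map_umbral {R' : Type} [CommRing R'] (f : R →+* R') (φ : (Fin (n + 1) →₀ ℕ) → R)
    (p : MvPolynomial (Fin r × Fin (n + 1)) R) :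
    f (umbral φ p) = umbral (fun α => f (φ α)) (map f p) := by
  classical
  rw [umbral, umbral, map_sum]
  simp only [map_mul, map_prod, ← coeff_map f p]
  refine (Finset.sum_subset (support_map_subset f p) fun m _ hm => ?_).symm
  rw [notMem_support_iff.1 hm, zero_mul]

/-- Expanding the product over letters of a sum over `i` gives one term for each choice `σ` of an
index per letter. -/
lemma umbral_sum_pow {ι : Type*} [Fintype ι] (l : ι → Fin (n + 1) → R)
    (p : MvPolynomial (Fin r × Fin (n + 1)) R) :
    umbral (fun α => ∑ i, ∏ j, l i j ^ α j) p =
      ∑ σ : Fin r → ι, eval (fun v => l (σ v.1) v.2) p := by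
  classical
  simp only [umbral, eval_eq', Fintype.prod_sum, Finset.mul_sum, Fintype.prod_prod_type,
    letterExponent_apply]
  rw [Finset.sum_comm]

end Umbral

/-! ### The invariant as an umbral expression -/

/-- The variable `f_α` if `α` has degree `d`, and zero otherwise. -/
def coordVar (n d : ℕ) (α : Fin (n + 1) →₀ ℕ) : CoordRing n d :=
  open scoped Classical in
  if h : α ∈ (Finset.univ : Finset (Fin (n + 1))).finsuppAntidiag d then X ⟨α, h⟩ else 0

lemma coordVar_of_mem {n d : ℕ} (α : MultiIndex n d) : coordVar n d α.1 = X α := by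
  rw [coordVar, dif_pos α.2]

/-- Since `α!` times the multinomial coefficient is `d!`, the factorials created by differentiation
cancel the normalisation `1/d!`. -/
lemma factorial_mul_coeff_genericForm (n d : ℕ) (α : Fin (n + 1) →₀ ℕ) :
    ((∏ j, (α j).factorial : ℕ) : CoordRing n d) * coeff α (genericForm n d) =
      (d.factorial : CoordRing n d) * coordVar n d α := by
  classical
  rw [genericForm, coeff_sum]
  simp only [coeff_monomial]
  by_cases h : α ∈ (Finset.univ : Finset (Fin (n + 1))).finsuppAntidiag d
  · rw [Finset.sum_eq_single (⟨α, h⟩ : MultiIndex n d) (fun β _ hβ => if_neg fun h' =>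
      hβ (Subtype.ext h')) (by simp), if_pos rfl, coordVar, dif_pos h, ← mul_assoc]
    congr 1
    rw [Finset.mem_finsuppAntidiag] at h
    have h1 := Nat.multinomial_spec (Finset.univ : Finset (Fin (n + 1))) α
    have h2 : α.multinomial = Nat.multinomial Finset.univ α :=
      (Finsupp.multinomial_of_support_subset (Finset.subset_univ _)).symm
    rw [h.1] at h1
    rw [← h1, h2]
    push_cast
    rfl
  · rw [Finset.sum_eq_zero fun β _ => if_neg fun h' => h (by rw [← h']; exact β.2), coordVar,
      dif_neg h, mul_zero, mul_zero]

lemma prod_map_smul {A M ι : Type*} [CommSemiring A] [Semiring M] [Algebra A M] (c : A)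
    (f : ι → M) (l : List ι) :
    (l.map fun a => c • f a).prod = c ^ l.length • (l.map f).prod := by
  induction l with
  | nil => simp
  | cons a l ih => simp [ih, pow_succ, smul_smul]

namespace BracketMonomial

variable {n r m : ℕ} (w : BracketMonomial n r m)

lemma invariant_eq_umbral (d : ℕ) :
    w.invariant d = umbral (coordVar n d) (w.symbol (CoordRing n d)) := by
  classical
  rw [invariant, List.ofFn_eq_map, prod_map_smul, List.length_finRange, LinearMap.smul_apply,
    constantCoeff_eq, coeff_smul, coeff_prod_letterOperator _ _ _ (List.nodup_finRange r) 0 (by simp),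
    umbral, Finset.smul_sum]
  refine Finset.sum_congr rfl fun μ _ => ?_
  rw [if_pos (by simp), ← List.ofFn_eq_map, List.prod_ofFn]
  have : ∀ a, ((∏ j, (μ (a, j)).factorial : ℕ) : CoordRing n d) *
      coeff (letterExponent μ a) (genericForm n d) =
        (d.factorial : CoordRing n d) * coordVar n d (letterExponent μ a) := fun a =>
    factorial_mul_coeff_genericForm n d (letterExponent μ a)
  simp_rw [this, Finset.prod_mul_distrib, Finset.prod_const, Finset.card_univ, Fintype.card_fin]
  have hd : ((d.factorial : ℂ)⁻¹ ^ r) • ((d.factorial : CoordRing n d) ^ r) = 1 := by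
    have : (d.factorial : CoordRing n d) = C (d.factorial : ℂ) := by simp
    rw [this, ← map_pow, smul_eq_C_mul, ← map_mul, ← mul_pow,
      inv_mul_cancel₀ (Nat.cast_ne_zero.2 d.factorial_ne_zero), one_pow, map_one]
  rw [mul_left_comm, ← smul_mul_assoc, hd, one_mul]

lemma map_symbol {R R' : Type} [CommRing R] [CommRing R'] (f : R →+* R') :
    map f (w.symbol R) = w.symbol R' := by
  rw [symbol, symbol, map_prod]
  refine Finset.prod_congr rfl fun b _ => ?_
  rw [RingHom.map_det]
  congr 1
  ext i j : 1
  simp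

lemma eval_symbol {R : Type} [CommRing R] (v : Fin r × Fin (n + 1) → R) :
    eval v (w.symbol R) = ∏ b, (Matrix.of fun i j => v (w b i, j)).det := by
  rw [symbol, map_prod]
  refine Finset.prod_congr rfl fun b _ => ?_
  rw [RingHom.map_det]
  congr 1
  ext i j : 1
  simp

/-- The coefficients are scalars, so the degree of the invariant comes only from the `r` letters,
one variable each. -/
lemma symbol_isHomogeneous_coeff (d : ℕ) (μ : Fin r × Fin (n + 1) →₀ ℕ) :
    (coeff μ (w.symbol (CoordRing n d))).IsHomogeneous 0 := by
  rw [← w.map_symbol (C : ℂ →+* CoordRing n d), coeff_map]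
  exact isHomogeneous_C _ _

lemma invariant_isHomogeneous (d : ℕ) : (w.invariant d).IsHomogeneous r := by
  rw [invariant_eq_umbral, umbral]
  refine IsHomogeneous.sum _ _ _ fun μ _ => ?_
  have h : (∏ a : Fin r, coordVar n d (letterExponent μ a)).IsHomogeneous
      (∑ _a : Fin r, 1) := by
    refine IsHomogeneous.prod _ _ _ fun a _ => ?_
    rw [coordVar]
    split_ifs
    · exact isHomogeneous_X _ _
    · exact isHomogeneous_zero _ _ _
  simpa using (w.symbol_isHomogeneous_coeff d μ).mul h

variable {w}

/-- A block with distinct letters contributes one variable of `a` if it contains `a` and none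
otherwise, and `d` blocks contain `a`. -/
lemma IsBiregular.symbol_isWeightedHomogeneous {d : ℕ} (hw : w.IsBiregular d) (a : Fin r)
    {R : Type} [CommRing R] :
    IsWeightedHomogeneous (fun v : Fin r × Fin (n + 1) => if v.1 = a then 1 else 0)
      (w.symbol R) d := by
  classical
  rw [← hw.2 a, Finset.card_filter, symbol]
  refine IsWeightedHomogeneous.prod _ _ _ fun b _ => ?_
  rw [Matrix.det_apply]
  refine IsWeightedHomogeneous.sum _ _ _ fun σ _ => ?_
  have h : IsWeightedHomogeneous (fun v : Fin r × Fin (n + 1) => if v.1 = a then 1 else 0)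
      (∏ i, (X (w b (σ i), i) : MvPolynomial (Fin r × Fin (n + 1)) R))
      (∑ i, if w b (σ i) = a then 1 else 0) :=
    IsWeightedHomogeneous.prod _ _ _ fun i _ => isWeightedHomogeneous_X _ _ _
  have hs : (∑ i, if w b (σ i) = a then 1 else 0) = if ∃ i, w b i = a then 1 else 0 := by
    rw [Equiv.sum_comp σ fun i => if w b i = a then 1 else 0]
    split_ifs with ha
    · obtain ⟨i, rfl⟩ := ha
      simp [(hw.1 b).eq_iff]
    · push Not at ha
      simp [ha]
  rw [hs] at h
  rw [Units.smul_def, zsmul_eq_mul]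
  simpa using (isWeightedHomogeneous_C _ ((Equiv.Perm.sign σ : ℤ) : R)).mul h

/-- Ensures that `coordVar` never takes its default value 0 on a monomial of the symbol. -/
lemma IsBiregular.letterExponent_mem {d : ℕ} (hw : w.IsBiregular d) {R : Type} [CommRing R]
    {μ : Fin r × Fin (n + 1) →₀ ℕ} (hμ : coeff μ (w.symbol R) ≠ 0) (a : Fin r) :
    letterExponent μ a ∈ (Finset.univ : Finset (Fin (n + 1))).finsuppAntidiag d := by
  have h := hw.symbol_isWeightedHomogeneous a hμ
  rw [Finsupp.weight_apply, Finsupp.sum_fintype _ _ (by simp), Fintype.sum_prod_type] at h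
  rw [Finset.mem_finsuppAntidiag]
  refine ⟨?_, Finset.subset_univ _⟩
  rw [← h, Finset.sum_eq_single a (fun b _ hb => by simp [hb]) (by simp)]
  exact Finset.sum_congr rfl fun j _ => by simp

lemma coords_sum_pow {ι : Type*} [Fintype ι] {d : ℕ} (l : ι → Fin (n + 1) → ℂ)
    (α : MultiIndex n d) :
    coords n d (∑ i, (∑ j, l i j • X j) ^ d) α = ∑ i, ∏ j, l i j ^ α.1 j := by
  have hα := Finset.mem_finsuppAntidiag.1 α.2
  have h0 : (α.1.multinomial : ℂ) ≠ 0 := by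
    rw [← Finsupp.multinomial_of_support_subset (Finset.subset_univ _)]
    exact Nat.cast_ne_zero.2 (Nat.multinomial_pos _ _).ne'
  rw [coords, coeff_sum, Finset.sum_div]
  refine Finset.sum_congr rfl fun i _ => ?_
  rw [coeff_linearCombination_X_pow_of_fintype, if_pos, mul_div_cancel_left₀ _ h0,
    Finsupp.prod_fintype _ _ (by simp)]
  rw [Finsupp.sum_fintype _ _ (by simp)]
  exact hα.1

lemma IsBiregular.eval_invariant {d : ℕ} (hw : w.IsBiregular d) {ι : Type*} [Fintype ι]
    (l : ι → Fin (n + 1) → ℂ) :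
    eval (coords n d (∑ i, (∑ j, l i j • X j) ^ d)) (w.invariant d) =
      ∑ σ : Fin r → ι, ∏ b, (Matrix.of fun i j => l (σ (w b i)) j).det := by
  rw [invariant_eq_umbral, map_umbral, w.map_symbol]
  trans umbral (fun α => ∑ i, ∏ j, l i j ^ α j) (w.symbol ℂ)
  · refine Finset.sum_congr rfl fun μ hμ => ?_
    congr 1
    refine Finset.prod_congr rfl fun a _ => ?_
    have := hw.letterExponent_mem (mem_support_iff.1 hμ) a
    exact (congrArg _ (coordVar_of_mem ⟨_, this⟩)).trans
      ((eval_X _).trans (coords_sum_pow l ⟨_, this⟩))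
  · simp only [umbral_sum_pow, eval_symbol]

end BracketMonomial

/-! ### Powers of linear forms span the space of forms -/

lemma linear_pow_eq_sum {n : ℕ} (d : ℕ) (l : Fin (n + 1) → ℂ) :
    (∑ j, l j • X j : MvPolynomial (Fin (n + 1)) ℂ) ^ d =
      ∑ α ∈ (Finset.univ : Finset (Fin (n + 1))).finsuppAntidiag d,
        ((α.multinomial : ℂ) * ∏ j, l j ^ α j) • monomial α 1 := by
  classical
  ext β
  rw [coeff_linearCombination_X_pow_of_fintype, coeff_sum]
  simp only [coeff_smul, coeff_monomial, smul_eq_mul, mul_ite, mul_one, mul_zero,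
    Finset.sum_ite_eq', Finset.mem_finsuppAntidiag, Finset.subset_univ, and_true]
  rw [Finsupp.sum_fintype _ _ (by simp), Finsupp.prod_fintype _ _ (by simp)]

/-- If a functional `f` kills all `L ^ d`, then `f (L ^ d)`, as a polynomial in the coefficients of
`L`, is zero; its coefficients are nonzero multiples of the values of `f` on monomials, so `f` kills
every form of degree `d`. -/
lemma mem_span_linear_pow {n d : ℕ} {F : MvPolynomial (Fin (n + 1)) ℂ} (hF : F.IsHomogeneous d) :
    F ∈ Submodule.span ℂ (Set.range fun l : Fin (n + 1) → ℂ =>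
      (∑ j, l j • X j : MvPolynomial (Fin (n + 1)) ℂ) ^ d) := by
  classical
  by_contra hnot
  obtain ⟨f, hfF, hf⟩ := Submodule.exists_le_ker_of_notMem hnot
  set P : MvPolynomial (Fin (n + 1)) ℂ :=
    ∑ α ∈ (Finset.univ : Finset (Fin (n + 1))).finsuppAntidiag d,
      monomial α ((α.multinomial : ℂ) * f (monomial α 1)) with hP
  have hP0 : P = 0 := by
    refine MvPolynomial.funext fun l => ?_
    have h : f ((∑ j, l j • X j) ^ d) = 0 := LinearMap.mem_ker.1 (hf (Submodule.subset_span ⟨l, rfl⟩))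
    rw [linear_pow_eq_sum, map_sum] at h
    rw [hP, map_sum, map_zero, ← h]
    refine Finset.sum_congr rfl fun α _ => ?_
    rw [eval_monomial, map_smul, Finsupp.prod_fintype _ _ (by simp), smul_eq_mul]
    ring
  have hcoef : ∀ α ∈ F.support, f (monomial α 1) = 0 := by
    intro α hα
    have hα' : α ∈ (Finset.univ : Finset (Fin (n + 1))).finsuppAntidiag d := by
      rw [Finset.mem_finsuppAntidiag]
      refine ⟨?_, Finset.subset_univ _⟩
      rw [← hF (mem_support_iff.1 hα), Finsupp.weight_apply, Finsupp.sum_fintype _ _ (by simp)]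
      simp
    have h := congrArg (coeff α) hP0
    rw [hP, coeff_sum] at h
    simp only [coeff_monomial, Finset.sum_ite_eq', hα', if_true, coeff_zero] at h
    refine (mul_eq_zero.1 h).resolve_left ?_
    rw [← Finsupp.multinomial_of_support_subset (Finset.subset_univ _)]
    exact Nat.cast_ne_zero.2 (Nat.multinomial_pos _ _).ne'
  apply hfF
  rw [F.as_sum, map_sum]
  refine Finset.sum_eq_zero fun α hα => ?_
  rw [← mul_one (coeff α F), ← smul_eq_mul, ← smul_monomial, map_smul, hcoef α hα, smul_zero]

lemma exists_eq_sum_linear_pow {n d : ℕ} (hd : d ≠ 0) {F : MvPolynomial (Fin (n + 1)) ℂ}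
    (hF : F.IsHomogeneous d) :
    ∃ (ι : Type) (_ : Fintype ι) (l : ι → Fin (n + 1) → ℂ), F = ∑ i, (∑ j, l i j • X j) ^ d := by
  have hspan := mem_span_linear_pow hF
  clear hF
  induction hspan using Submodule.span_induction with
  | mem x hx =>
    obtain ⟨l, rfl⟩ := hx
    exact ⟨Unit, inferInstance, fun _ => l, by simp⟩
  | zero => exact ⟨Empty, inferInstance, Empty.elim, by simp⟩
  | add x y _ _ hx hy =>
    obtain ⟨ι, _, l, rfl⟩ := hx
    obtain ⟨κ, _, l', rfl⟩ := hy
    exact ⟨ι ⊕ κ, inferInstance, Sum.elim l l', by simp⟩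
  | smul c x _ hx =>
    obtain ⟨ι, _, l, rfl⟩ := hx
    -- A `d`-th root of the scalar is absorbed into the linear forms.
    obtain ⟨z, rfl⟩ := IsAlgClosed.exists_pow_nat_eq c (Nat.pos_of_ne_zero hd)
    refine ⟨ι, inferInstance, fun i => z • l i, ?_⟩
    rw [Finset.smul_sum]
    refine Finset.sum_congr rfl fun i _ => ?_
    rw [← smul_pow, Finset.smul_sum]
    simp [smul_smul]

lemma exists_eq_linear {n : ℕ} {L : MvPolynomial (Fin (n + 1)) ℂ} (hL : L.IsHomogeneous 1) :
    ∃ l : Fin (n + 1) → ℂ, L = ∑ j, l j • X j := by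
  obtain ⟨ι, _, l, rfl⟩ := exists_eq_sum_linear_pow one_ne_zero hL
  refine ⟨fun j => ∑ i, l i j, ?_⟩
  simp only [pow_one, Finset.sum_smul]
  exact Finset.sum_comm

lemma linear_isHomogeneous {n : ℕ} (l : Fin (n + 1) → ℂ) :
    (∑ j, l j • X j : MvPolynomial (Fin (n + 1)) ℂ).IsHomogeneous 1 :=
  IsHomogeneous.sum _ _ _ fun j _ => by
    rw [smul_eq_C_mul]
    simpa using (isHomogeneous_C _ (l j)).mul (isHomogeneous_X ℂ j)

/-- On a sum of powers, substitution multiplies each coefficient vector by `g`, hence each bracket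
by `det g = 1`. -/
lemma BracketMonomial.IsBiregular.eval_invariant_substitute {n r m d : ℕ} (hd : d ≠ 0)
    {w : BracketMonomial n r m} (hw : w.IsBiregular d)
    (g : Matrix.SpecialLinearGroup (Fin (n + 1)) ℂ) {F : MvPolynomial (Fin (n + 1)) ℂ}
    (hF : F.IsHomogeneous d) :
    eval (coords n d (substitute g.1 F)) (w.invariant d) =
      eval (coords n d F) (w.invariant d) := by
  obtain ⟨ι, _, l, rfl⟩ := exists_eq_sum_linear_pow hd hF
  have h : substitute g.1 (∑ i, (∑ j, l i j • X j) ^ d) =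
      ∑ i, (∑ j, (Matrix.vecMul (l i) g.1) j • X j) ^ d := by
    rw [substitute, map_sum]
    refine Finset.sum_congr rfl fun i _ => ?_
    rw [map_pow, map_sum]
    congr 1
    simp only [map_smul, aeval_X, Matrix.vecMul, dotProduct, Finset.smul_sum, Finset.sum_smul]
    rw [Finset.sum_comm]
    simp only [← smul_eq_C_mul, smul_smul]
  rw [h, hw.eval_invariant, hw.eval_invariant]
  refine Finset.sum_congr rfl fun σ _ => Finset.prod_congr rfl fun b _ => ?_
  have h2 : (Matrix.of fun i j => (Matrix.vecMul (l (σ (w b i))) g.1) j) =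
      (Matrix.of fun i j => l (σ (w b i)) j) * g.1 := by
    ext i j
    rfl
  rw [h2, Matrix.det_mul, g.2, mul_one]

/-! ### The sextic invariant of ternary quartics -/

lemma quarticBrackets_isBiregular : quarticBrackets.IsBiregular 4 := by
  constructor
  · decide
  · decide

lemma quarticBrackets_collinear :
    ∀ u v : Fin 6, u ≠ v → ∃ b, (∃ i, quarticBrackets b i = u) ∧ ∃ j, quarticBrackets b j = v := by
  decide

lemma collinearityGraph_quarticBrackets : quarticBrackets.collinearityGraph = ⊤ := by
  ext u v
  rw [SimpleGraph.top_adj]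
  exact ⟨fun h => h.1, fun h => ⟨h, quarticBrackets_collinear u v h⟩⟩

/-- Two letters with the same image lie in a common bracket, which then has two equal rows. -/
lemma prod_det_quarticBrackets_eq_zero {ι : Type*} (l : ι → Fin 3 → ℂ) {σ : Fin 6 → ι}
    (hσ : ¬ Function.Injective σ) :
    ∏ b, (Matrix.of fun i j => l (σ (quarticBrackets b i)) j).det = 0 := by
  rw [Function.not_injective_iff] at hσ
  obtain ⟨u, v, huv, hne⟩ := hσ
  obtain ⟨b, ⟨i, rfl⟩, j, rfl⟩ := quarticBrackets_collinear u v hne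
  refine Finset.prod_eq_zero (Finset.mem_univ b) (Matrix.det_zero_of_row_eq (i := i) (j := j) ?_ ?_)
  · rintro rfl
    exact hne rfl
  · funext k
    simp [huv]

lemma eval_invariant_sum_five (l : Fin 5 → Fin 3 → ℂ) :
    eval (coords 2 4 (∑ i, (∑ j, l i j • X j) ^ 4)) (quarticBrackets.invariant 4) = 0 := by
  rw [quarticBrackets_isBiregular.eval_invariant]
  refine Finset.sum_eq_zero fun σ _ => prod_det_quarticBrackets_eq_zero l fun h => ?_
  simpa using Fintype.card_le_of_injective σ h

/-- Six points of the plane which do not lie on a conic. -/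
def sixPoints : Fin 6 → Fin 3 → ℤ :=
  ![![1, 0, 0], ![0, 1, 0], ![0, 0, 1], ![1, 1, 0], ![0, 1, 1], ![1, 1, 1]]

/-- The determinant of three of the six points. -/
def sixPointsDet (i j k : Fin 6) : ℤ :=
  sixPoints i 0 * (sixPoints j 1 * sixPoints k 2 - sixPoints j 2 * sixPoints k 1) -
  sixPoints i 1 * (sixPoints j 0 * sixPoints k 2 - sixPoints j 2 * sixPoints k 0) +
  sixPoints i 2 * (sixPoints j 0 * sixPoints k 1 - sixPoints j 1 * sixPoints k 0)

lemma sum_perm_sixPoints : ∑ σ : Equiv.Perm (Fin 6), ∏ b, sixPointsDet (σ (quarticBrackets b 0))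
    (σ (quarticBrackets b 1)) (σ (quarticBrackets b 2)) = 216 := by
  decide +kernel

lemma invariant_quarticBrackets_ne_zero : quarticBrackets.invariant 4 ≠ 0 := by
  intro h0
  have h := quarticBrackets_isBiregular.eval_invariant fun i j => (sixPoints i j : ℂ)
  rw [h0, map_zero] at h
  have h1 : ∑ σ : Equiv.Perm (Fin 6), ∏ b,
      (Matrix.of fun i j => (sixPoints (σ (quarticBrackets b i)) j : ℂ)).det = 216 := by
    have := congrArg (Int.cast : ℤ → ℂ) sum_perm_sixPoints
    push_cast at this
    rw [← this]
    refine Finset.sum_congr rfl fun σ _ => Finset.prod_congr rfl fun b _ => ?_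
    rw [Matrix.det_fin_three, sixPointsDet]
    push_cast
    simp only [Matrix.of_apply]
    ring
  have h2 : ∑ σ : Fin 6 → Fin 6, ∏ b,
      (Matrix.of fun i j => (sixPoints (σ (quarticBrackets b i)) j : ℂ)).det = 216 := by
    rw [← h1]
    symm
    -- Non-injective maps contribute zero, leaving the sum over permutations.
    refine Finset.sum_of_injOn (fun σ : Equiv.Perm (Fin 6) => (σ : Fin 6 → Fin 6))
      (DFunLike.coe_injective.injOn) (by simp) (fun σ _ hσ => ?_) (fun _ _ => rfl)
    refine prod_det_quarticBrackets_eq_zero (fun i j => (sixPoints i j : ℂ)) fun hinj => hσ ?_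
    exact ⟨Equiv.ofBijective σ (Finite.injective_iff_bijective.1 hinj), by simp, rfl⟩
  rw [h2] at h
  norm_num at h

/-! ### Irreducibility of the catalecticant determinant -/

section Corner

variable {σ : Type*} {k : ℕ}

/-- The part of a determinant which does not involve the upper left entry. -/
def cornerRemainder {R : Type*} [CommRing R] (A : Matrix (Fin (k + 1)) (Fin (k + 1)) R) : R :=
  ∑ j : Fin k, (-1) ^ (j.succ : ℕ) * A 0 j.succ *
    (A.submatrix Fin.succ j.succ.succAbove).det

lemma det_eq_corner {R : Type*} [CommRing R] (A : Matrix (Fin (k + 1)) (Fin (k + 1)) R) :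
    A.det = (A.submatrix Fin.succ Fin.succ).det * A 0 0 + cornerRemainder A := by
  rw [Matrix.det_succ_row_zero, Fin.sum_univ_succ, cornerRemainder]
  congr 1
  simp [mul_comm]

lemma det_mem_subalgebra {R A : Type*} [CommRing R] [CommRing A] [Algebra R A]
    (S : Subalgebra R A) {m : ℕ} (B : Matrix (Fin m) (Fin m) A) (hB : ∀ i j, B i j ∈ S) :
    B.det ∈ S := by
  rw [Matrix.det_apply]
  refine S.sum_mem fun τ _ => ?_
  rw [Units.smul_def, zsmul_eq_mul]
  exact S.mul_mem (S.intCast_mem _) (S.prod_mem fun i _ => hB _ _)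

variable {c : Fin (k + 1) → Fin (k + 1) → σ}

lemma det_submatrix_succ_mem_supported (hc : ∀ i j, (i, j) ≠ (0, 0) → c i j ≠ c 0 0) :
    (Matrix.of fun i j : Fin k => (X (c i.succ j.succ) : MvPolynomial σ ℂ)).det ∈
      supported ℂ ({c 0 0}ᶜ : Set σ) :=
  det_mem_subalgebra _ _ fun i j => X_mem_supported.2 (hc _ _ (by simp))

lemma cornerRemainder_mem_supported (hc : ∀ i j, (i, j) ≠ (0, 0) → c i j ≠ c 0 0) :
    cornerRemainder (Matrix.of fun i j => (X (c i j) : MvPolynomial σ ℂ)) ∈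
      supported ℂ ({c 0 0}ᶜ : Set σ) := by
  refine Subalgebra.sum_mem _ fun j _ => Subalgebra.mul_mem _ (Subalgebra.mul_mem _ ?_ ?_) ?_
  · exact Subalgebra.pow_mem _ (Subalgebra.neg_mem _ (Subalgebra.one_mem _)) _
  · exact X_mem_supported.2 (hc _ _ (by simp))
  · exact det_mem_subalgebra _ _ fun i j => X_mem_supported.2 (hc _ _ (by simp))

lemma eval_det_X {m : ℕ} (c : Fin m → Fin m → σ) (x : σ → ℂ) :
    eval x (Matrix.of fun i j => (X (c i j) : MvPolynomial σ ℂ)).det =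
      (Matrix.of fun i j => x (c i j)).det := by
  rw [RingHom.map_det]
  congr 1
  ext i j : 1
  simp

lemma notMem_vars_of_mem_supported_compl {v : σ} {p : MvPolynomial σ ℂ}
    (hp : p ∈ supported ℂ ({v}ᶜ : Set σ)) : v ∉ p.vars := fun h =>
  mem_supported.1 hp h rfl

/-- The determinant is `M * X + N` with `X` the corner variable, absent from `M` and `N`, and `M`
irreducible. It can only be reducible if `M` divides `N`, hence the determinant; a point where `M`
vanishes and the determinant does not excludes this. -/
lemma irreducible_det_of_corner (hc : ∀ i j, (i, j) ≠ (0, 0) → c i j ≠ c 0 0)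
    (hirr : Irreducible
      (Matrix.of fun i j : Fin k => (X (c i.succ j.succ) : MvPolynomial σ ℂ)).det)
    (x : σ → ℂ) (hx0 : (Matrix.of fun i j : Fin k => x (c i.succ j.succ)).det = 0)
    (hx : (Matrix.of fun i j => x (c i j)).det ≠ 0) :
    Irreducible (Matrix.of fun i j => (X (c i j) : MvPolynomial σ ℂ)).det := by
  have hdet := det_eq_corner (Matrix.of fun i j => (X (c i j) : MvPolynomial σ ℂ))
  have hsub : (Matrix.of fun i j => (X (c i j) : MvPolynomial σ ℂ)).submatrix Fin.succ Fin.succ =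
      Matrix.of fun i j : Fin k => X (c i.succ j.succ) := rfl
  rw [hsub] at hdet
  rw [hdet]
  refine irreducible_mul_X_add _ _ (c 0 0) hirr.ne_zero
    (notMem_vars_of_mem_supported_compl (det_submatrix_succ_mem_supported hc))
    (notMem_vars_of_mem_supported_compl (cornerRemainder_mem_supported hc))
    (hirr.isRelPrime_iff_not_dvd.2 fun hdvd => hx ?_)
  have h2 := (Dvd.dvd.mul_right (dvd_refl _) _).add hdvd |> fun h => hdet ▸ h
  obtain ⟨q, hq⟩ := h2
  rw [← eval_det_X, hq, map_mul, eval_det_X, hx0, zero_mul]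

end Corner

/-- The exponents of the monomials of degree two, in the order `x², xy, xz, y², yz, z²`. -/
def quadricExponent : Fin 6 → Fin 3 → ℕ :=
  ![![2, 0, 0], ![1, 1, 0], ![1, 0, 1], ![0, 2, 0], ![0, 1, 1], ![0, 0, 2]]

/-- The exponent of the product of two monomials of degree two. -/
def catIndex (i j : Fin 6) : MultiIndex 2 4 :=
  ⟨Finsupp.equivFunOnFinite.symm (quadricExponent i + quadricExponent j), by
    rw [Finset.mem_finsuppAntidiag]
    refine ⟨?_, Finset.subset_univ _⟩
    have : ∀ i j : Fin 6, ∑ l, (quadricExponent i + quadricExponent j) l = 4 := by decide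
    exact this i j⟩

@[simp] lemma catIndex_apply (i j : Fin 6) (l : Fin 3) :
    (catIndex i j).1 l = quadricExponent i l + quadricExponent j l := rfl

lemma catIndex_ne {i j i' j' : Fin 6}
    (h : ∃ l, quadricExponent i l + quadricExponent j l ≠
      quadricExponent i' l + quadricExponent j' l) : catIndex i j ≠ catIndex i' j' := by
  obtain ⟨l, hl⟩ := h
  exact fun h => hl (by rw [← catIndex_apply, h, catIndex_apply])

/-- The catalecticant matrix of a ternary quartic. -/
def catMatrix : Matrix (Fin 6) (Fin 6) (CoordRing 2 4) :=
  Matrix.of fun i j => X (catIndex i j)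

/-- The minor of the catalecticant matrix obtained by deleting `x²`. -/
def catMinor : CoordRing 2 4 :=
  (Matrix.of fun i j : Fin 5 => (X (catIndex i.succ j.succ) : CoordRing 2 4)).det

/-- The value at `(i, j)` of the form whose coefficients are one for the exponents in `s` and zero
otherwise. -/
def indicatorEntry (s : List (Fin 3 → ℕ)) (i j : Fin 6) : ℤ :=
  if quadricExponent i + quadricExponent j ∈ s then 1 else 0

lemma exists_eval_catIndex (s : List (Fin 3 → ℕ)) :
    ∃ x : MultiIndex 2 4 → ℂ, ∀ i j, x (catIndex i j) = (indicatorEntry s i j : ℂ) := by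
  refine ⟨fun α => ((if ⇑α.1 ∈ s then 1 else 0 : ℤ) : ℂ), fun i j => ?_⟩
  rfl

/-- The submatrix of the catalecticant matrix with rows and columns `e`. -/
def catSubmatrix {k : ℕ} (e : Fin k → Fin 6) : Matrix (Fin k) (Fin k) (CoordRing 2 4) :=
  Matrix.of fun i j => X (catIndex (e i) (e j))

/-- The catalecticant submatrix with rows and columns `e` of an indicator form. -/
def indicatorMatrix {k : ℕ} (s : List (Fin 3 → ℕ)) (e : Fin k → Fin 6) :
    Matrix (Fin k) (Fin k) ℤ :=
  Matrix.of fun i j => indicatorEntry s (e i) (e j)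

lemma eval_det_catSubmatrix {k : ℕ} {s : List (Fin 3 → ℕ)} {x : MultiIndex 2 4 → ℂ}
    (hx : ∀ i j, x (catIndex i j) = (indicatorEntry s i j : ℂ)) (e : Fin k → Fin 6) :
    eval x (catSubmatrix e).det = ((indicatorMatrix s e).det : ℂ) := by
  rw [catSubmatrix, eval_det_X (fun i j => catIndex (e i) (e j)), Int.cast_det]
  simp only [hx]
  rfl

lemma irreducible_det_of_indicator {k : ℕ} (e : Fin (k + 1) → Fin 6) (e' : Fin k → Fin 6)
    (he : ∀ i, e i.succ = e' i) (s : List (Fin 3 → ℕ))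
    (hc : ∀ i j, (i, j) ≠ (0, 0) → ∃ l, quadricExponent (e i) l + quadricExponent (e j) l ≠
      quadricExponent (e 0) l + quadricExponent (e 0) l)
    (hirr : Irreducible (catSubmatrix e').det)
    (hs0 : (indicatorMatrix s e').det = 0) (hs : (indicatorMatrix s e).det ≠ 0) :
    Irreducible (catSubmatrix e).det := by
  obtain ⟨x, hx⟩ := exists_eval_catIndex s
  obtain rfl : e' = fun i => e i.succ := funext fun i => (he i).symm
  refine irreducible_det_of_corner (c := fun i j => catIndex (e i) (e j))
    (fun i j hij => catIndex_ne (hc i j hij)) hirr x ?_ ?_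
  · rw [← eval_det_X]
    exact (eval_det_catSubmatrix hx _).trans (by rw [hs0, Int.cast_zero])
  · rw [← eval_det_X]
    exact (eval_det_catSubmatrix hx _).trans_ne (Int.cast_ne_zero.2 hs)

lemma irreducible_det_one : Irreducible (catSubmatrix ![5]).det := by
  rw [Matrix.det_unique]
  have := irreducible_mul_X_add (1 : CoordRing 2 4) 0 (catIndex 5 5) one_ne_zero (by simp)
    (by simp) isRelPrime_one_left
  rw [one_mul, add_zero] at this
  exact this

/-- The matrix grows by one row and column at a time. In this and the next three lemmas the
exponents set to 1 turn the larger matrix into a permutation matrix with corner entry 0, so the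
minor is singular. -/
lemma irreducible_det_two : Irreducible (catSubmatrix ![4, 5]).det :=
  irreducible_det_of_indicator _ _ (by decide) [![0, 1, 3]] (by decide)
    irreducible_det_one (by decide +kernel) (by decide +kernel)

lemma irreducible_det_three : Irreducible (catSubmatrix ![3, 4, 5]).det :=
  irreducible_det_of_indicator _ _ (by decide) [![0, 2, 2]] (by decide)
    irreducible_det_two (by decide +kernel) (by decide +kernel)

lemma irreducible_det_four : Irreducible (catSubmatrix ![2, 3, 4, 5]).det :=
  irreducible_det_of_indicator _ _ (by decide)
    [![0, 0, 4], ![0, 4, 0], ![1, 1, 2]] (by decide)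
    irreducible_det_three (by decide +kernel) (by decide +kernel)

lemma irreducible_catMinor : Irreducible catMinor :=
  irreducible_det_of_indicator Fin.succ _ (by decide)
    [![0, 2, 2], ![2, 1, 1]] (by decide)
    irreducible_det_four (by decide +kernel) (by decide +kernel)

/-- Among these exponents only `x³y` meets the row of `xy`, in the column of `x²`; deleting that
column leaves a zero row. -/
lemma det_indicator_catMinor :
    (indicatorMatrix [![0, 2, 2], ![2, 0, 2], ![3, 1, 0]] (Fin.succ : Fin 5 → Fin 6)).det = 0 := by
  decide +kernel

lemma det_indicator_catMatrix :
    (indicatorMatrix [![0, 2, 2], ![2, 0, 2], ![3, 1, 0]] (id : Fin 6 → Fin 6)).det ≠ 0 := by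
  decide +kernel

/-- The coefficient of `x⁴` occurs only in the corner, which makes the determinant linear in it. -/
lemma catIndex_ne_zero : ∀ i j : Fin 6, (i, j) ≠ (0, 0) → catIndex i j ≠ catIndex 0 0 := by
  have : ∀ i j : Fin 6, (i, j) ≠ (0, 0) → ∃ l, quadricExponent i l + quadricExponent j l ≠
      quadricExponent 0 l + quadricExponent 0 l := by decide
  exact fun i j h => catIndex_ne (this i j h)

lemma prime_det_catMatrix : Prime catMatrix.det := by
  refine Irreducible.prime ?_
  exact irreducible_det_of_indicator id Fin.succ (by decide) _ (by decide) irreducible_catMinor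
    det_indicator_catMinor det_indicator_catMatrix

lemma not_det_catMatrix_dvd_catMinor : ¬ catMatrix.det ∣ catMinor := by
  intro h
  obtain ⟨x, hx⟩ := exists_eval_catIndex [![0, 2, 2], ![2, 0, 2], ![3, 1, 0]]
  obtain ⟨q, hq⟩ := (prime_det_catMatrix.irreducible.associated_of_dvd irreducible_catMinor h).symm.dvd
  have h1 : eval x catMatrix.det ≠ 0 :=
    (eval_det_catSubmatrix hx id).trans_ne (Int.cast_ne_zero.2 det_indicator_catMatrix)
  have h2 : eval x catMinor = 0 :=
    (eval_det_catSubmatrix hx Fin.succ).trans (by rw [det_indicator_catMinor, Int.cast_zero])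
  rw [hq, map_mul, h2, zero_mul] at h1
  exact h1 rfl

/-- Pseudo-division by a polynomial which is linear in one variable. -/
lemma exists_pseudo_division {σ : Type*} (v : σ) {M N : MvPolynomial σ ℂ}
    (hM : M ∈ supported ℂ ({v}ᶜ : Set σ)) (hN : N ∈ supported ℂ ({v}ᶜ : Set σ))
    (P : MvPolynomial σ ℂ) :
    ∃ (k : ℕ) (Q R : MvPolynomial σ ℂ), R ∈ supported ℂ ({v}ᶜ : Set σ) ∧
      M ^ k * P = Q * (M * X v + N) + R := by
  induction P using MvPolynomial.induction_on with
  | C a => exact ⟨0, 0, C a, Subalgebra.algebraMap_mem _ a, by simp⟩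
  | add p q hp hq =>
    obtain ⟨k, Q, R, hR, h⟩ := hp
    obtain ⟨k', Q', R', hR', h'⟩ := hq
    refine ⟨k + k', M ^ k' * Q + M ^ k * Q', M ^ k' * R + M ^ k * R',
      Subalgebra.add_mem _ (Subalgebra.mul_mem _ (Subalgebra.pow_mem _ hM _) hR)
        (Subalgebra.mul_mem _ (Subalgebra.pow_mem _ hM _) hR'), ?_⟩
    linear_combination M ^ k' * h + M ^ k * h'
  | mul_X p i hp =>
    obtain ⟨k, Q, R, hR, h⟩ := hp
    by_cases hi : i = v
    · subst hi
      -- One more factor `M` allows `R * M * X i` to be rewritten as `R * (M * X i + N) - R * N`.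
      refine ⟨k + 1, Q * M * X i + R, -(R * N),
        Subalgebra.neg_mem _ (Subalgebra.mul_mem _ hR hN), ?_⟩
      linear_combination M * X i * h
    · refine ⟨k, Q * X i, R * X i, Subalgebra.mul_mem _ hR (X_mem_supported.2 hi), ?_⟩
      linear_combination X i * h

lemma det_catMatrix_eq : catMatrix.det = catMinor * X (catIndex 0 0) + cornerRemainder catMatrix :=
  det_eq_corner catMatrix

/-- The catalecticant determinant vanishes on sums of five fourth powers. -/
lemma eval_det_catMatrix_sum_five (l : Fin 5 → Fin 3 → ℂ) :
    eval (coords 2 4 (∑ i, (∑ j, l i j • X j) ^ 4)) catMatrix.det = 0 := by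
  rw [catMatrix, eval_det_X]
  -- The catalecticant factors as 6×5 times 5×6; a zero column and a zero row make both factors
  -- square.
  have h : (Matrix.of fun i j => coords 2 4 (∑ i, (∑ j, l i j • X j) ^ 4) (catIndex i j)) =
      (Matrix.of fun i t : Fin 6 => Fin.lastCases (motive := fun _ => ℂ) 0
        (fun s : Fin 5 => ∏ j, l s j ^ quadricExponent i j) t) *
      (Matrix.of fun t i : Fin 6 => Fin.lastCases (motive := fun _ => ℂ) 0
        (fun s : Fin 5 => ∏ j, l s j ^ quadricExponent i j) t) := by
    ext i j
    simp only [Matrix.of_apply, Matrix.mul_apply]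
    rw [BracketMonomial.coords_sum_pow, Fin.sum_univ_castSucc (n := 5)]
    simp only [Fin.lastCases_castSucc, Fin.lastCases_last, mul_zero, add_zero, catIndex_apply,
      pow_add, Finset.prod_mul_distrib]
  rw [h, Matrix.det_mul, Matrix.det_eq_zero_of_column_eq_zero (Fin.last 5)
    fun i => by rw [Matrix.of_apply, Fin.lastCases_last], zero_mul]

/-! ### A Jacobian criterion for algebraic independence -/

section Jacobian

variable {σ τ : Type*}

lemma pderiv_aeval [Fintype σ] (φ : σ → MvPolynomial τ ℂ) (j : τ) (R : MvPolynomial σ ℂ) :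
    pderiv j (aeval φ R) = ∑ a, aeval φ (pderiv a R) * pderiv j (φ a) := by
  classical
  induction R using MvPolynomial.induction_on with
  | C a => simp [algebraMap_eq]
  | add p q hp hq => simp only [map_add, hp, hq, add_mul, Finset.sum_add_distrib]
  | mul_X p i hp =>
    simp only [map_mul, aeval_X, Derivation.leibniz, smul_eq_mul, map_add, hp, pderiv_X,
      add_mul, Finset.sum_add_distrib, Finset.mul_sum]
    congr 1
    · rw [Finset.sum_eq_single i (fun b _ hb => by simp [hb.symm]) (by simp)]
      simp
    · exact Finset.sum_congr rfl fun a _ => by ring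

lemma coeff_eq_zero_of_pderiv_eq_zero {R : MvPolynomial σ ℂ} (h : ∀ a, pderiv a R = 0)
    {m : σ →₀ ℕ} (hm : m ≠ 0) : coeff m R = 0 := by
  classical
  obtain ⟨a, ha⟩ := Finsupp.ne_iff.1 hm
  rw [Finsupp.zero_apply] at ha
  have h1 := coeff_pderiv (i := a) R (m - Finsupp.single a 1)
  have h2 : m - Finsupp.single a 1 + Finsupp.single a 1 = m :=
    tsub_add_cancel_of_le (Finsupp.single_le_iff.2 (Nat.one_le_iff_ne_zero.2 ha))
  rw [h a, coeff_zero, h2] at h1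
  exact (mul_eq_zero.1 h1.symm).resolve_right (Nat.cast_add_one_ne_zero _)

lemma totalDegree_pderiv_le {R : MvPolynomial σ ℂ} {n : ℕ} (h : R.totalDegree ≤ n + 1) (a : σ) :
    (pderiv a R).totalDegree ≤ n := by
  classical
  refine Finset.sup_le fun m hm => ?_
  rw [mem_support_iff, coeff_pderiv] at hm
  have h1 := (le_totalDegree (mem_support_iff.2 (left_ne_zero_of_mul hm))).trans h
  rw [Finsupp.sum_add_index' (by simp) (by simp), Finsupp.sum_single_index rfl] at h1
  omega

lemma pderiv_mem_supported {s : Set σ} {R : MvPolynomial σ ℂ} (hR : R ∈ supported ℂ s) (a : σ) :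
    pderiv a R ∈ supported ℂ s := by
  classical
  rw [mem_supported] at hR ⊢
  intro b hb
  refine hR ?_
  rw [Finset.mem_coe, mem_vars_iff_mem_support] at hb ⊢
  obtain ⟨m, hm, hbm⟩ := hb
  rw [mem_support_iff, coeff_pderiv] at hm
  refine ⟨_, mem_support_iff.2 (left_ne_zero_of_mul hm), ?_⟩
  rw [Finsupp.mem_support_iff] at hbm ⊢
  simp [hbm]

/-- Differentiating `R(φ) = 0` by the chain rule gives a linear relation among the gradients of the
`φ a`, with coefficients `(∂R/∂a)(φ)`. These therefore vanish, and induction on the degree gives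
`∂R/∂a = 0` for all `a`, so `R` is constant. -/
lemma eq_zero_of_aeval_eq_zero [Fintype σ] (φ : σ → MvPolynomial τ ℂ) (s : Set σ)
    (hφ : ∀ c : σ → MvPolynomial τ ℂ, (∀ a ∉ s, c a = 0) →
      (∀ j, ∑ a, c a * pderiv j (φ a) = 0) → c = 0)
    {R : MvPolynomial σ ℂ} (hR : R ∈ supported ℂ s) (h : aeval φ R = 0) : R = 0 := by
  classical
  have hconst : ∀ R : MvPolynomial σ ℂ, (∀ m ≠ 0, coeff m R = 0) → aeval φ R = 0 → R = 0 := by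
    intro R hm h0
    have hC : R = C (coeff 0 R) := by
      ext m
      rw [coeff_C]
      split_ifs with hm0
      · rw [hm0]
      · exact hm m (Ne.symm hm0)
    rw [hC, aeval_C, algebraMap_eq, C_eq_zero] at h0
    rw [hC, h0, C_0]
  obtain ⟨n, hn⟩ : ∃ n, R.totalDegree ≤ n := ⟨_, le_rfl⟩
  induction n generalizing R with
  | zero =>
    refine hconst R (fun m hm => ?_) h
    rw [totalDegree_eq_zero_iff_eq_C.1 (Nat.le_zero.1 hn), coeff_C, if_neg (Ne.symm hm)]
  | succ n ih =>
    have hc := hφ (fun a => aeval φ (pderiv a R))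
      (fun a ha => by
        rw [pderiv_eq_zero_of_notMem_vars fun h => ha (mem_supported.1 hR h), map_zero])
      (fun j => by rw [← pderiv_aeval, h, map_zero])
    exact hconst R (fun m => coeff_eq_zero_of_pderiv_eq_zero fun a =>
      ih (pderiv_mem_supported hR a) (congrFun hc a) (totalDegree_pderiv_le hn a)) h

/-- Linear independence of polynomial vectors may be checked at one point. -/
lemma eq_zero_of_vecMul_eq_zero_of_eval {κ η : Type*} [Fintype κ] [Fintype η]
    (J : κ → η → MvPolynomial τ ℂ) (x : τ → ℂ)
    (hx : ∀ c : κ → ℂ, (∀ j, ∑ a, c a * eval x (J a j) = 0) → c = 0)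
    (c : κ → MvPolynomial τ ℂ) (hc : ∀ j, ∑ a, c a * J a j = 0) : c = 0 := by
  classical
  let J0 : Matrix κ η ℂ := Matrix.of fun a j => eval x (J a j)
  have hinj : LinearMap.ker (Matrix.vecMulLinear J0) = ⊥ := by
    rw [LinearMap.ker_eq_bot']
    exact fun c h => hx c fun j => congrFun h j
  obtain ⟨g, hg⟩ := LinearMap.exists_leftInverse_of_injective _ hinj
  let A : Matrix η κ ℂ := Matrix.of fun j a => g (Pi.single j 1) a
  have hA : J0 * A = 1 := by
    ext b a
    have h1 := congrFun (LinearMap.congr_fun hg (Pi.single b 1)) a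
    rw [LinearMap.comp_apply, Matrix.vecMulLinear_apply, Matrix.single_one_vecMul,
      LinearMap.id_apply, pi_eq_sum_univ (J0.row b), map_sum, Finset.sum_apply] at h1
    rw [Matrix.mul_apply, Matrix.one_eq_pi_single, ← h1]
    refine Finset.sum_congr rfl fun j _ => ?_
    rw [map_smul, Pi.smul_apply, smul_eq_mul]
    have hs : (Pi.single j 1 : η → ℂ) = fun k => if j = k then 1 else 0 := by
      funext k
      simp [Pi.single_apply, eq_comm]
    rw [← hs]
    rfl
  let J' : Matrix κ η (MvPolynomial τ ℂ) := Matrix.of J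
  let A' : Matrix η κ (MvPolynomial τ ℂ) := A.map C
  -- The constant right inverse `A` of `J0` makes `det (J' * A')` equal to 1 at `x`, so it is a
  -- nonzero polynomial.
  refine Matrix.eq_zero_of_vecMul_eq_zero (M := J' * A') (fun h0 => ?_) ?_
  · have h1 := congrArg (eval x) h0
    have h2 : J'.map (eval x) = J0 := rfl
    have h3 : A'.map (eval x) = A := by
      ext
      simp [A']
    rw [RingHom.map_det, map_zero, RingHom.mapMatrix_apply, Matrix.map_mul, h2, h3, hA,
      Matrix.det_one] at h1
    exact one_ne_zero h1
  · rw [← Matrix.vecMul_vecMul]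
    have : Matrix.vecMul c J' = 0 := funext hc
    rw [this, Matrix.zero_vecMul]

end Jacobian

/-! ### The ideal of the variety of sums of five fourth powers -/

/-- The exponents of the monomials of degree four in three variables. -/
def quarticExponent : Fin 15 → Fin 3 → ℕ :=
  ![![4, 0, 0], ![3, 1, 0], ![3, 0, 1], ![2, 2, 0], ![2, 1, 1], ![2, 0, 2], ![1, 3, 0], ![1, 2, 1],
    ![1, 1, 2], ![1, 0, 3], ![0, 4, 0], ![0, 3, 1], ![0, 2, 2], ![0, 1, 3], ![0, 0, 4]]

/-- The enumeration of the multi-indices of degree four in three variables. -/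
def quarticIndex (k : Fin 15) : MultiIndex 2 4 :=
  ⟨Finsupp.equivFunOnFinite.symm (quarticExponent k), by
    rw [Finset.mem_finsuppAntidiag]
    refine ⟨?_, Finset.subset_univ _⟩
    have : ∀ k, ∑ l, quarticExponent k l = 4 := by decide
    exact this k⟩

lemma quarticIndex_bijective : Function.Bijective quarticIndex := by
  constructor
  · intro k k' h
    have hinj : ∀ k k', quarticExponent k = quarticExponent k' → k = k' := by decide +kernel
    exact hinj k k' (congrArg (fun α : MultiIndex 2 4 => ⇑α.1) h)
  · intro α
    have hα : ∑ i, α.1 i = 4 := (Finset.mem_finsuppAntidiag.1 α.2).1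
    rw [Fin.sum_univ_three] at hα
    have hsurj : ∀ a b c : Fin 5, (a + b + c : ℕ) = 4 → ∃ k, quarticExponent k 0 = a ∧
        quarticExponent k 1 = b ∧ quarticExponent k 2 = c := by decide +kernel
    obtain ⟨k, h0, h1, h2⟩ := hsurj ⟨α.1 0, by omega⟩ ⟨α.1 1, by omega⟩ ⟨α.1 2, by omega⟩ hα
    refine ⟨k, Subtype.ext (Finsupp.ext fun j => ?_)⟩
    fin_cases j
    · exact h0
    · exact h1
    · exact h2

/-- Five general points of the plane. -/
def fivePoints : Fin 5 → Fin 3 → ℂ :=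
  ![![0, 1, 0], ![0, 0, 1], ![1, 1, 1], ![1, -1, -1], ![2, 4, 1]]

/-- The polynomial `∑_i l_i^α` in the coefficients of five linear forms `l_i`. -/
def powerSum (α : MultiIndex 2 4) : MvPolynomial (Fin 5 × Fin 3) ℂ :=
  ∑ i, ∏ j, X (i, j) ^ α.1 j

lemma eval_powerSum (l : Fin 5 → Fin 3 → ℂ) (α : MultiIndex 2 4) :
    eval (fun v => l v.1 v.2) (powerSum α) = ∑ i, ∏ j, l i j ^ α.1 j := by
  simp [powerSum]

lemma eval_aeval_powerSum (l : Fin 5 → Fin 3 → ℂ) (P : CoordRing 2 4) :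
    eval (fun v => l v.1 v.2) (aeval powerSum P) =
      eval (coords 2 4 (∑ i, (∑ j, l i j • X j) ^ 4)) P := by
  have h : coords 2 4 (∑ i, (∑ j, l i j • X j) ^ 4) =
      fun α => eval (fun v => l v.1 v.2) (powerSum α) := funext fun α => by
    rw [eval_powerSum, BracketMonomial.coords_sum_pow]
  rw [h]
  induction P using MvPolynomial.induction_on with
  | C a => simp [algebraMap_eq]
  | add p q hp hq => simp only [map_add, hp, hq]
  | mul_X p i hp => simp only [map_mul, hp, aeval_X, eval_X]

lemma eval_pderiv_powerSum (l : Fin 5 → Fin 3 → ℂ) (α : MultiIndex 2 4) (i : Fin 5) (j : Fin 3) :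
    eval (fun v => l v.1 v.2) (pderiv (i, j) (powerSum α)) =
      α.1 j * ∏ j', l i j' ^ (α.1 j' - if j = j' then 1 else 0) := by
  classical
  have h : ∀ i', pderiv (i, j) (∏ j', X (i', j') ^ α.1 j' : MvPolynomial (Fin 5 × Fin 3) ℂ) =
      if i' = i then C (α.1 j : ℂ) * ∏ j', X (i, j') ^ (α.1 j' - if j = j' then 1 else 0)
      else 0 := by
    intro i'
    split_ifs with hi
    · subst hi
      fin_cases j <;>
        simp [Fin.prod_univ_three, Derivation.leibniz, Derivation.leibniz_pow, pderiv_X] <;> ring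
    · simp [Fin.prod_univ_three, Derivation.leibniz, Derivation.leibniz_pow, pderiv_X, hi]
  rw [powerSum, map_sum, Finset.sum_congr rfl fun i' _ => h i', Finset.sum_ite_eq' Finset.univ i,
    if_pos (Finset.mem_univ _)]
  simp

/-- Read `c` as the coefficients of a quartic singular at the five points. These lie on the smooth
conic `x² = yz`, so by Bézout the quartic is a multiple of `(x² - yz)²`; `c 0 = 0` says that its
`x⁴` coefficient vanishes, which forces it to be zero. The proof solves the linear system directly.
-/
lemma fivePoints_nondegenerate (c : Fin 15 → ℂ) (h0 : c 0 = 0)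
    (h : ∀ i j, ∑ k, c k * (quarticExponent k j * ∏ j', fivePoints i j' ^
      (quarticExponent k j' - if j = j' then 1 else 0)) = 0) : c = 0 := by
  have h00 := h 0 0
  have h01 := h 0 1
  have h02 := h 0 2
  have h10 := h 1 0
  have h11 := h 1 1
  have h12 := h 1 2
  have h20 := h 2 0
  have h21 := h 2 1
  have h22 := h 2 2
  have h30 := h 3 0
  have h31 := h 3 1
  have h32 := h 3 2
  have h40 := h 4 0
  have h41 := h 4 1
  have h42 := h 4 2
  simp [Fin.sum_univ_succ, Fin.prod_univ_three, quarticExponent, fivePoints, h0] at h00 h01 h02 h10 h11 h12 h20 h21 h22 h30 h31 h32 h40 h41 h42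
  -- The two coordinate points already kill the coefficients of monomials with `y` or `z` to a power
  -- at least 3; eight unknowns remain.
  simp only [h00, h01, h02, h10, h11, h12] at h20 h21 h22 h30 h31 h32 h40 h41 h42
  have h1 : c 1 = 0 := by grind
  have h2 : c 2 = 0 := by grind
  have h3 : c 3 = 0 := by grind
  have h4 : c 4 = 0 := by grind
  have h5 : c 5 = 0 := by grind
  have h7 : c 7 = 0 := by grind
  have h8 : c 8 = 0 := by grind
  have h12' : c 12 = 0 := by grind
  funext k
  fin_cases k <;> assumption

lemma eq_zero_of_mem_supported_of_eval_eq_zero {R : CoordRing 2 4}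
    (hR : R ∈ supported ℂ ({catIndex 0 0}ᶜ : Set (MultiIndex 2 4)))
    (h : ∀ l : Fin 5 → Fin 3 → ℂ,
      eval (coords 2 4 (∑ i, (∑ j, l i j • X j) ^ 4)) R = 0) : R = 0 := by
  classical
  have hidx : quarticIndex 0 = catIndex 0 0 := by
    refine Subtype.ext (Finsupp.ext fun j => ?_)
    fin_cases j <;> rfl
  refine eq_zero_of_aeval_eq_zero powerSum _ (fun c hc0 hc => ?_) hR ?_
  -- The extra column `none` encodes the vanishing of the `x⁴` entry of `c` as one more linear
  -- equation.
  · refine eq_zero_of_vecMul_eq_zero_of_eval (η := Option (Fin 5 × Fin 3))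
      (fun α j => j.elim (if α = catIndex 0 0 then 1 else 0) fun v => pderiv v (powerSum α))
      (fun v => fivePoints v.1 v.2) (fun b hb => ?_) c fun j => ?_
    · have hk := fivePoints_nondegenerate (fun k => b (quarticIndex k))
        (by simpa [hidx, apply_ite] using hb none) fun i j => by
          rw [← hb (some (i, j)), ← quarticIndex_bijective.sum_comp]
          refine Finset.sum_congr rfl fun k _ => ?_
          rw [Option.elim_some, eval_pderiv_powerSum]
          rfl
      funext α
      obtain ⟨k, rfl⟩ := quarticIndex_bijective.2 α
      exact congrFun hk k
    · cases j with
      | none => simpa using hc0 (catIndex 0 0) (by simp)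
      | some v => exact hc v
  · refine MvPolynomial.funext fun x => ?_
    rw [map_zero, ← h fun i j => x (i, j), ← eval_aeval_powerSum]

lemma catMinor_mem_supported :
    catMinor ∈ supported ℂ ({catIndex 0 0}ᶜ : Set (MultiIndex 2 4)) :=
  det_submatrix_succ_mem_supported (k := 5) (c := catIndex) catIndex_ne_zero

lemma cornerRemainder_catMatrix_mem_supported :
    cornerRemainder catMatrix ∈ supported ℂ ({catIndex 0 0}ᶜ : Set (MultiIndex 2 4)) :=
  cornerRemainder_mem_supported (k := 5) (c := catIndex) catIndex_ne_zero

theorem det_catMatrix_dvd {P : CoordRing 2 4}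
    (h : ∀ l : Fin 5 → Fin 3 → ℂ,
      eval (coords 2 4 (∑ i, (∑ j, l i j • X j) ^ 4)) P = 0) : catMatrix.det ∣ P := by
  obtain ⟨k, Q, R, hR, hdiv⟩ := exists_pseudo_division (catIndex 0 0)
    catMinor_mem_supported cornerRemainder_catMatrix_mem_supported P
  rw [← det_catMatrix_eq] at hdiv
  have hR0 : R = 0 := eq_zero_of_mem_supported_of_eval_eq_zero hR fun l => by
    have := congrArg (eval (coords 2 4 (∑ i, (∑ j, l i j • X j) ^ 4))) hdiv
    rw [map_mul, map_add, map_mul, h l, eval_det_catMatrix_sum_five, mul_zero, mul_zero,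
      zero_add] at this
    exact this.symm
  rw [hR0, add_zero] at hdiv
  have hdvd : catMatrix.det ∣ catMinor ^ k * P := Dvd.intro_left Q hdiv.symm
  refine (prime_det_catMatrix.dvd_or_dvd hdvd).resolve_left fun hM => ?_
  exact not_det_catMatrix_dvd_catMinor (prime_det_catMatrix.dvd_of_dvd_pow hM)

/-! ### The secant variety -/

lemma vanishingIdeal_zariskiClosure {n d : ℕ} (S : Set (Projectivization ℂ (Form n d))) :
    vanishingIdeal (zariskiClosure S) = vanishingIdeal S := by
  refine le_antisymm (fun P hP p hp => ?_) fun P hP p hp => hp P hP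
  exact hP p fun Q hQ => hQ p hp

/-- The fourth power of a linear form, as an element of the space of quartics. -/
def linearPow (l : Fin 3 → ℂ) : Form 2 4 :=
  ⟨(∑ j, l j • X j) ^ 4, by
    simpa using (linear_isHomogeneous l).pow 4⟩

lemma linearPow_single_ne_zero : linearPow (Pi.single 0 1) ≠ 0 := by
  intro h
  have h1 : (∑ j, (Pi.single 0 1 : Fin 3 → ℂ) j • X j : MvPolynomial (Fin 3) ℂ) ^ 4 = 0 :=
    congrArg Subtype.val h
  have h2 : (∑ j, (Pi.single 0 1 : Fin 3 → ℂ) j • X j : MvPolynomial (Fin 3) ℂ) = X 0 := by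
    simp
  rw [h2] at h1
  exact X_ne_zero 0 (pow_eq_zero_iff (by norm_num)|>.1 h1)

lemma mk_linearPow_mem_veronese {l : Fin 3 → ℂ} (h : linearPow l ≠ 0) :
    Projectivization.mk ℂ (linearPow l) h ∈ veronese 2 4 :=
  ⟨linearPow l, h, _, linear_isHomogeneous l, rfl, rfl⟩

lemma mem_vanishingIdeal_secantVariety {P : CoordRing 2 4} :
    P ∈ vanishingIdeal (secantVariety 5 (veronese 2 4)) ↔
      ∀ l : Fin 5 → Fin 3 → ℂ, eval (coords 2 4 (∑ i, (∑ j, l i j • X j) ^ 4)) P = 0 := by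
  classical
  rw [secantVariety, vanishingIdeal_zariskiClosure]
  constructor
  · intro hP l
    -- A zero linear form defines no point, so an arbitrary Veronese point replaces it; its line
    -- still contains 0.
    let q : Fin 5 → Projectivization ℂ (Form 2 4) := fun i =>
      if h : linearPow (l i) = 0 then Projectivization.mk ℂ _ linearPow_single_ne_zero
      else Projectivization.mk ℂ _ h
    have hq : ∀ i, q i ∈ veronese 2 4 := fun i => by
      dsimp only [q]
      split_ifs with h
      · exact mk_linearPow_mem_veronese linearPow_single_ne_zero
      · exact mk_linearPow_mem_veronese h
    have hmem : ∀ i, linearPow (l i) ∈ (q i).submodule := fun i => by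
      dsimp only [q]
      split_ifs with h
      · rw [h]
        exact zero_mem _
      · rw [Projectivization.submodule_mk]
        exact Submodule.mem_span_singleton_self _
    have hval : (∑ i, linearPow (l i) : Form 2 4).1 = ∑ i, (∑ j, l i j • X j) ^ 4 := by
      rw [AddSubmonoidClass.coe_finsetSum]
      rfl
    rw [← hval]
    by_cases h0 : ∑ i, linearPow (l i) = 0
    · rw [h0]
      exact hP (q 0) ⟨q, hq, le_iSup (fun i => (q i).submodule) 0⟩ 0 (zero_mem _)
    · refine hP (Projectivization.mk ℂ _ h0) ⟨q, hq, ?_⟩ _ ?_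
      · rw [Projectivization.submodule_mk, Submodule.span_singleton_le_iff_mem]
        exact Submodule.sum_mem _ fun i _ => Submodule.mem_iSup_of_mem i (hmem i)
      · rw [Projectivization.submodule_mk]
        exact Submodule.mem_span_singleton_self _
  · rintro hP p ⟨q, hq, hp⟩ F hF
    choose G hG L hL hGL hqG using hq
    have hsup : ⨆ i, (q i).submodule = Submodule.span ℂ (Set.range G) := by
      rw [Submodule.span_range_eq_iSup]
      exact iSup_congr fun i => by rw [hqG i, Projectivization.submodule_mk]
    have hFmem := hp hF
    rw [hsup, Submodule.mem_span_range_iff_exists_fun] at hFmem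
    obtain ⟨c, rfl⟩ := hFmem
    choose l hl using fun i => exists_eq_linear (hL i)
    choose z hz using fun i => IsAlgClosed.exists_pow_nat_eq (c i) (show 0 < 4 by norm_num)
    have hval : (∑ i, c i • G i : Form 2 4).1 = ∑ i, (∑ j, (z i • l i) j • X j) ^ 4 := by
      rw [AddSubmonoidClass.coe_finsetSum]
      refine Finset.sum_congr rfl fun i _ => ?_
      rw [Submodule.coe_smul, hGL i, hl i, ← hz i, ← smul_pow, Finset.smul_sum]
      simp [smul_smul]
    rw [hval]
    exact hP _

lemma det_catMatrix_isHomogeneous : catMatrix.det.IsHomogeneous 6 := by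
  rw [Matrix.det_apply]
  refine IsHomogeneous.sum _ _ _ fun τ _ => ?_
  have h : (∏ i, catMatrix (τ i) i).IsHomogeneous (∑ _i : Fin 6, 1) :=
    IsHomogeneous.prod _ _ _ fun i _ => isHomogeneous_X _ _
  rw [Units.smul_def, zsmul_eq_mul]
  simpa using (isHomogeneous_C _ ((Equiv.Perm.sign τ : ℤ) : ℂ)).mul h

/-- The determinant divides the nonzero invariant and both have degree 6, so the quotient is a
nonzero constant. -/
lemma associated_det_catMatrix_invariant :
    Associated catMatrix.det (quarticBrackets.invariant 4) := by
  obtain ⟨q, hq⟩ := det_catMatrix_dvd eval_invariant_sum_five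
  have hI := invariant_quarticBrackets_ne_zero
  have hq0 : q ≠ 0 := by
    rintro rfl
    exact hI (by rw [hq, mul_zero])
  have hdeg := (quarticBrackets.invariant_isHomogeneous 4).totalDegree hI
  rw [hq, totalDegree_mul_of_isDomain prime_det_catMatrix.ne_zero hq0,
    det_catMatrix_isHomogeneous.totalDegree prime_det_catMatrix.ne_zero] at hdeg
  have hqC := totalDegree_eq_zero_iff_eq_C.1 (show q.totalDegree = 0 by omega)
  have hunit : IsUnit q := by
    rw [hqC] at hq0 ⊢
    exact (isUnit_iff_ne_zero.2 fun h => hq0 (by rw [h, C_0])).map C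
  rw [hq]
  exact (associated_mul_unit_right _ _ hunit)

lemma vanishingIdeal_secantVariety :
    vanishingIdeal (secantVariety 5 (veronese 2 4)) =
      Ideal.span {quarticBrackets.invariant 4} := by
  rw [← Ideal.span_singleton_eq_span_singleton.2 associated_det_catMatrix_invariant]
  ext P
  rw [mem_vanishingIdeal_secantVariety, Ideal.mem_span_singleton]
  refine ⟨det_catMatrix_dvd, ?_⟩
  rintro ⟨Q, rfl⟩ l
  rw [map_mul, eval_det_catMatrix_sum_five, zero_mul]

lemma codimension_secantVariety : codimension (secantVariety 5 (veronese 2 4)) = 1 := by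
  rw [codimension, vanishingIdeal_secantVariety]
  exact Ideal.height_span_singleton_eq_one_of_mem_nonZeroDivisors
    (mem_nonZeroDivisors_of_ne_zero invariant_quarticBrackets_ne_zero)
    (associated_det_catMatrix_invariant.prime prime_det_catMatrix).not_isUnit

lemma secantVariety_eq_zeroLocus_vanishingIdeal {n d k : ℕ} (X : Set (Projectivization ℂ (Form n d))) :
    secantVariety k X = {p | ∀ P ∈ vanishingIdeal (secantVariety k X), VanishesAt P p} := by
  rw [secantVariety, vanishingIdeal_zariskiClosure]
  rfl

lemma secantVariety_eq_zeroLocus : secantVariety 5 (veronese 2 4) =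
    {p | VanishesAt (quarticBrackets.invariant 4) p} := by
  rw [secantVariety_eq_zeroLocus_vanishingIdeal, vanishingIdeal_secantVariety]
  ext p
  refine ⟨fun h => h _ (Ideal.mem_span_singleton_self _), fun h P hP F hF => ?_⟩
  obtain ⟨Q, rfl⟩ := Ideal.mem_span_singleton.1 hP
  rw [map_mul, h F hF, zero_mul]

lemma chromaticNumber_quarticBrackets :
    quarticBrackets.collinearityGraph.chromaticNumber = 6 := by
  rw [collinearityGraph_quarticBrackets, SimpleGraph.chromaticNumber_top]
  simp

end VeroneseSecant

end

theorem mainTheorem2 :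
    VeroneseSecant.quarticBrackets.IsBiregular 4 ∧
    -- a degree-6 invariant of ternary quartics
    (VeroneseSecant.quarticBrackets.invariant 4).IsHomogeneous 6 ∧
    (∀ (g : Matrix.SpecialLinearGroup (Fin 3) ℂ) (F : MvPolynomial (Fin 3) ℂ),
      F.IsHomogeneous 4 →
      MvPolynomial.eval (VeroneseSecant.coords 2 4 (VeroneseSecant.substitute (n := 2) g.1 F))
          (VeroneseSecant.quarticBrackets.invariant 4) =
        MvPolynomial.eval (VeroneseSecant.coords 2 4 F)
          (VeroneseSecant.quarticBrackets.invariant 4)) ∧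
    -- it is not identically zero
    VeroneseSecant.quarticBrackets.invariant 4 ≠ 0 ∧
    -- it is the defining equation of the hypersurface `σ_5(v_4(ℙ²))`
    VeroneseSecant.codimension
      (VeroneseSecant.secantVariety 5 (VeroneseSecant.veronese 2 4)) = 1 ∧
    VeroneseSecant.secantVariety 5 (VeroneseSecant.veronese 2 4) =
      {p | VeroneseSecant.VanishesAt (VeroneseSecant.quarticBrackets.invariant 4) p} ∧
    VeroneseSecant.vanishingIdeal
        (VeroneseSecant.secantVariety 5 (VeroneseSecant.veronese 2 4)) =
      Ideal.span {VeroneseSecant.quarticBrackets.invariant 4} ∧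
    -- the collinearity graph is complete, and has no proper 5-coloring
    VeroneseSecant.quarticBrackets.collinearityGraph = ⊤ ∧
    ¬ VeroneseSecant.quarticBrackets.collinearityGraph.Colorable 5 ∧
    VeroneseSecant.quarticBrackets.collinearityGraph.chromaticNumber = 6 ∧
    -- the invariant vanishes on sums of five fourth powers of linear forms
    (∀ L : Fin 5 → MvPolynomial (Fin 3) ℂ, (∀ i, (L i).IsHomogeneous 1) →
      MvPolynomial.eval (VeroneseSecant.coords 2 4 (∑ i, L i ^ 4))
        (VeroneseSecant.quarticBrackets.invariant 4) = 0) ∧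
    VeroneseSecant.IsChromaticTriple 5 4 2 := by
  refine ⟨VeroneseSecant.quarticBrackets_isBiregular,
    VeroneseSecant.quarticBrackets.invariant_isHomogeneous 4,
    fun g F hF => VeroneseSecant.quarticBrackets_isBiregular.eval_invariant_substitute
      four_ne_zero g hF,
    VeroneseSecant.invariant_quarticBrackets_ne_zero,
    VeroneseSecant.codimension_secantVariety,
    VeroneseSecant.secantVariety_eq_zeroLocus,
    VeroneseSecant.vanishingIdeal_secantVariety,
    VeroneseSecant.collinearityGraph_quarticBrackets, fun h => ?_,
    VeroneseSecant.chromaticNumber_quarticBrackets, fun L hL => ?_,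
    VeroneseSecant.codimension_secantVariety, 6, 8, VeroneseSecant.quarticBrackets,
    VeroneseSecant.quarticBrackets_isBiregular, VeroneseSecant.vanishingIdeal_secantVariety, ?_⟩
  · have h1 := h.chromaticNumber_le
    rw [VeroneseSecant.chromaticNumber_quarticBrackets] at h1
    exact absurd h1 (by decide)
  · choose l hl using fun i => VeroneseSecant.exists_eq_linear (hL i)
    simp only [hl]
    exact VeroneseSecant.eval_invariant_sum_five l
  · rw [VeroneseSecant.chromaticNumber_quarticBrackets]
    norm_num
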